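/- Let $Q$ be a finite-dimensional smooth manifold and $L\colon TQ\to\mathbf R$ a smooth function (lagrangian). For a map between vector bundles over $Q$ that preserves the fibres, $D$ denotes the fibre derivative, i.e. the ordinary derivative along the fibres. Let $\mathcal F = DL\colon TQ\to T^*Q$ be the Legendre map, $W = D\mathcal F\colon TQ\to \mathrm{Hom}(TQ,T^*Q)$ the fibre hessian and $E(v)=\langle DL(v),v\rangle - L(v)$ the energy. For a smooth function $h$ on an open set $U\subset T^*Q$, its fibre derivatives are regarded as maps $Dh\colon U\to TQ$ and $D^2h\colon U\to\mathrm{Hom}(T^*Q,TQ)$ through the identification $T^{**}Q\cong TQ$, and $\gamma_h = Dh\circ\mathcal F\colon \mathcal F^{-1}(U)\to TQ$. Assume that $L$ is almost regular: $\mathcal F$ has connected fibres and is a submersion onto a closed submanifold $\mathcal F(TQ)$ of $T^*Q$. Let $U\subset T^*Q$ be open, let $(\phi_\mu)$ be a finite set of independent primary hamiltonian constraints on $U$ (smooth functions on $U$ with $\mathcal F(TQ)\cap U=\{p\in U : \phi_\mu(p)=0 \text{ for all } \mu\}$ whose differentials $d\phi_\mu$ are linearly independent at the points of $\mathcal F(TQ)\cap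 U$), and let $H$ be a hamiltonian on $U$ (a smooth function on $U$ with $E = H\circ\mathcal F$ on $\mathcal F^{-1}(U)$). Write $\gamma_\mu=\gamma_{\phi_\mu}$. Then there exist smooth functions $\lambda^\mu$ on the open set $\mathcal F^{-1}(U)\subset TQ$ such that on $\mathcal F^{-1}(U)$ $$\mathrm{Id}_{TQ} = \gamma_H + \sum_\mu \gamma_\mu\,\lambda^\mu ,$$ and moreover, for every $v\in\mathcal F^{-1}(U)$ in the fibre $T_qQ$, $$\mathrm{Id}_{T_qQ} = M(v)\circ W(v) + \sum_\mu \gamma_\mu(v)\otimes D\lambda^\mu(v),$$ where $M = D^2H\circ\mathcal F + \sum_\mu (D^2\phi_\mu\circ\mathcal F)\,\lambda^\mu\colon \mathcal F^{-1}(U)\to\mathrm{Hom}(T^*Q,TQ)$. -/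

import Mathlib

open Bundle Set Filter Topology
open scoped Manifold ContDiff

noncomputable section

namespace FibreDer

section Calculus

variable {Q : Type*}

/-- The fibre derivative of a fibre preserving map `f : A → B` between (the total spaces of) vector
bundles over `Q`, given by its restrictions `f q : A q → B q` to the fibres: at the point `a` of
the fibre over `q` it is the ordinary derivative of `f q` at `a`, an element of
`Hom(A q, B q)`. -/
def fibreDeriv {A B : Q → Type*}
    [∀ q, AddCommGroup (A q)] [∀ q, Module ℝ (A q)] [∀ q, TopologicalSpace (A q)]
    [∀ q, AddCommGroup (B q)] [∀ q, Module ℝ (B q)] [∀ q, TopologicalSpace (B q)]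
    (f : ∀ q, A q → B q) : ∀ q, A q → (A q →L[ℝ] B q) :=
  fun q a => fderiv ℝ (f q) a

/-- A finite dimensional space is canonically isomorphic to its bidual, through evaluation. -/
def bidualEquiv (V : Type*) [NormedAddCommGroup V] [NormedSpace ℝ V] [FiniteDimensional ℝ V] :
    V ≃L[ℝ] ((V →L[ℝ] ℝ) →L[ℝ] ℝ) :=
  (LinearEquiv.ofInjectiveOfFinrankEq
    (NormedSpace.inclusionInDoubleDual ℝ V : V →ₗ[ℝ] ((V →L[ℝ] ℝ) →L[ℝ] ℝ))
    (NormedSpace.inclusionInDoubleDualLi (𝕜 := ℝ) (E := V)).injective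
    (by
      have h : ∀ (X : Type _) [NormedAddCommGroup X] [NormedSpace ℝ X] [FiniteDimensional ℝ X],
          Module.finrank ℝ (X →L[ℝ] ℝ) = Module.finrank ℝ X := fun X _ _ _ => by
        rw [← (LinearMap.toContinuousLinearMap (𝕜 := ℝ) (E := X) (F' := ℝ)).finrank_eq]
        exact Subspace.dual_finrank_eq
      rw [h, h])).toContinuousLinearEquiv

theorem bidualEquiv_apply (V : Type*) [NormedAddCommGroup V] [NormedSpace ℝ V]
    [FiniteDimensional ℝ V] (v : V) (α : V →L[ℝ] ℝ) : bidualEquiv V v α = α v := rfl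

end Calculus

section Submanifold

variable {E' : Type*} [NormedAddCommGroup E'] [NormedSpace ℝ E']
  {H' : Type*} [TopologicalSpace H'] (J : ModelWithCorners ℝ E' H')
  {N : Type*} [TopologicalSpace N] [ChartedSpace H' N]

/-- A subset `S` of a manifold is an (embedded, smooth) submanifold when around each of its points
there is a smooth chart of the ambient manifold in which `S` becomes an affine subspace. -/
def IsSubmanifold (S : Set N) : Prop :=
  ∀ p ∈ S, ∃ e ∈ IsManifold.maximalAtlas J ∞ N, p ∈ e.source ∧
    ∃ K : Submodule ℝ E', ∀ x ∈ e.source, x ∈ S ↔ e.extend J x - e.extend J p ∈ K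

/-- The vectors tangent to `S` at `p`: the velocities at time `0` of the smooth curves
that lie in `S` and pass through `p`. -/
def tangentTo (S : Set N) (p : N) : Set (TangentSpace J p) :=
  {w | ∃ c : ℝ → N, ContMDiffAt 𝓘(ℝ, ℝ) J ∞ c 0 ∧ (∀ᶠ t in 𝓝 (0 : ℝ), c t ∈ S) ∧
    (⟨c 0, mfderiv 𝓘(ℝ, ℝ) J c 0 (1 : ℝ)⟩ : TangentBundle J N) = ⟨p, w⟩}

end Submanifold

section Lagrangian

variable {E : Type*} [NormedAddCommGroup E] [NormedSpace ℝ E]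
  {Q : Type*} [TopologicalSpace Q] [ChartedSpace E Q]

/-- The cotangent space `T*_q Q`. -/
abbrev CotangentSpace (E : Type*) [NormedAddCommGroup E] [NormedSpace ℝ E]
    {Q : Type*} [TopologicalSpace Q] [ChartedSpace E Q] (q : Q) : Type _ :=
  TangentSpace 𝓘(ℝ, E) q →L[ℝ] ℝ

/-- The cotangent bundle `T*Q`, with the smooth structure that Mathlib puts on a bundle of
continuous linear maps. -/
abbrev CotangentBundle (E : Type*) [NormedAddCommGroup E] [NormedSpace ℝ E]
    (Q : Type*) [TopologicalSpace Q] [ChartedSpace E Q] : Type _ :=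
  TotalSpace (E →L[ℝ] ℝ) (fun q : Q => CotangentSpace E q)

/-- The model with corners of the tangent bundle. -/
abbrev modelT (E : Type*) [NormedAddCommGroup E] [NormedSpace ℝ E] :
    ModelWithCorners ℝ (E × E) (ModelProd E E) :=
  𝓘(ℝ, E).prod 𝓘(ℝ, E)

/-- The model with corners of the cotangent bundle. -/
abbrev modelCoT (E : Type*) [NormedAddCommGroup E] [NormedSpace ℝ E] :
    ModelWithCorners ℝ (E × (E →L[ℝ] ℝ)) (ModelProd E (E →L[ℝ] ℝ)) :=
  𝓘(ℝ, E).prod 𝓘(ℝ, E →L[ℝ] ℝ)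

/-- The fibre derivative `D g (v) ∈ T*_q Q` of a function `g` on `TQ` at `v ∈ T_q Q`. -/
def DT (g : TangentBundle 𝓘(ℝ, E) Q → ℝ) (v : TangentBundle 𝓘(ℝ, E) Q) :
    CotangentSpace E v.1 :=
  fibreDeriv (A := fun q : Q => TangentSpace 𝓘(ℝ, E) q) (B := fun _ => ℝ)
    (fun q w => g ⟨q, w⟩) v.1 v.2

/-- The Legendre map `ℱ = D L : TQ → T*Q`. -/
def legendre (L : TangentBundle 𝓘(ℝ, E) Q → ℝ) (v : TangentBundle 𝓘(ℝ, E) Q) :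
    CotangentBundle E Q :=
  ⟨v.1, DT L v⟩

/-- The fibre hessian `W = D ℱ : TQ → Hom(TQ, T*Q)`. -/
def hessian (L : TangentBundle 𝓘(ℝ, E) Q → ℝ) (v : TangentBundle 𝓘(ℝ, E) Q) :
    TangentSpace 𝓘(ℝ, E) v.1 →L[ℝ] CotangentSpace E v.1 :=
  fibreDeriv (A := fun q : Q => TangentSpace 𝓘(ℝ, E) q) (B := fun q : Q => CotangentSpace E q)
    (fun q w => (legendre L ⟨q, w⟩).2) v.1 v.2

/-- The energy `E(v) = ⟨D L(v), v⟩ - L(v)`. -/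
def energy (L : TangentBundle 𝓘(ℝ, E) Q → ℝ) (v : TangentBundle 𝓘(ℝ, E) Q) : ℝ :=
  DT L v v.2 - L v

variable [FiniteDimensional ℝ E]

/-- The canonical isomorphism `T_q Q ≅ T**_q Q`. -/
def toBidual (q : Q) :
    TangentSpace 𝓘(ℝ, E) q ≃L[ℝ] (CotangentSpace E q →L[ℝ] ℝ) :=
  bidualEquiv E

theorem toBidual_apply (q : Q) (v : TangentSpace 𝓘(ℝ, E) q) (α : CotangentSpace E q) :
    toBidual q v α = α v := rfl

/-- The fibre derivative `D h (p) ∈ T**_q Q ≅ T_q Q` of a function `h` on `T*Q`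
at `p ∈ T*_q Q`. -/
def DCoT (h : CotangentBundle E Q → ℝ) (p : CotangentBundle E Q) : TangentSpace 𝓘(ℝ, E) p.1 :=
  (toBidual p.1).symm
    (fibreDeriv (A := fun q : Q => CotangentSpace E q) (B := fun _ => ℝ)
      (fun q α => h ⟨q, α⟩) p.1 p.2)

/-- The second fibre derivative `D² h (p) ∈ Hom(T*_q Q, T_q Q)` of a function `h` on `T*Q`
at `p ∈ T*_q Q`. -/
def D2CoT (h : CotangentBundle E Q → ℝ) (p : CotangentBundle E Q) :
    CotangentSpace E p.1 →L[ℝ] TangentSpace 𝓘(ℝ, E) p.1 :=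
  fibreDeriv (A := fun q : Q => CotangentSpace E q) (B := fun q : Q => TangentSpace 𝓘(ℝ, E) q)
    (fun q α => DCoT h ⟨q, α⟩) p.1 p.2

/-- The map `γ_h = D h ∘ ℱ : TQ → TQ` over the identity of `Q`. -/
def gam (L : TangentBundle 𝓘(ℝ, E) Q → ℝ) (h : CotangentBundle E Q → ℝ)
    (v : TangentBundle 𝓘(ℝ, E) Q) : TangentSpace 𝓘(ℝ, E) v.1 :=
  DCoT h (legendre L v)

variable [IsManifold 𝓘(ℝ, E) ∞ Q]

/-- A smooth lagrangian is almost regular when its Legendre map has connected fibres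
and is a submersion onto a closed submanifold of `T*Q`. -/
structure AlmostRegular (L : TangentBundle 𝓘(ℝ, E) Q → ℝ) : Prop where
  smooth : ContMDiff (modelT E) 𝓘(ℝ, ℝ) ∞ L
  isClosed_range : IsClosed (range (legendre L))
  isSubmanifold_range : IsSubmanifold (modelCoT E) (range (legendre L))
  submersion : ∀ v, range (mfderiv (modelT E) (modelCoT E) (legendre L) v) =
    tangentTo (modelCoT E) (range (legendre L)) (legendre L v)
  connected_fibres : ∀ p ∈ range (legendre L), IsConnected (legendre L ⁻¹' {p})

/-- `φ_μ` is an independent set of primary hamiltonian constraints on the open set `U` of `T*Q`: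
these are smooth functions on `U`, their vanishing defines the primary constraint submanifold
`ℱ(TQ)` inside `U`, and their differentials are linearly independent at its points. -/
structure IsIndependentPrimaryConstraints {ι : Type*} (L : TangentBundle 𝓘(ℝ, E) Q → ℝ)
    (U : Set (CotangentBundle E Q)) (φ : ι → CotangentBundle E Q → ℝ) : Prop where
  smooth : ∀ μ, ContMDiffOn (modelCoT E) 𝓘(ℝ, ℝ) ∞ (φ μ) U
  mem_range_iff : ∀ p ∈ U, p ∈ range (legendre L) ↔ ∀ μ, φ μ p = 0
  independent : ∀ p ∈ U, p ∈ range (legendre L) →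
    LinearIndependent ℝ (fun μ => mvfderiv (modelCoT E) (φ μ) p)

/-- `H` is a hamiltonian for `L` on the open set `U` of `T*Q`: a smooth function with
`E = H ∘ ℱ` wherever the right hand side is defined. -/
structure IsHamiltonian (L : TangentBundle 𝓘(ℝ, E) Q → ℝ)
    (U : Set (CotangentBundle E Q)) (H : CotangentBundle E Q → ℝ) : Prop where
  smooth : ContMDiffOn (modelCoT E) 𝓘(ℝ, ℝ) ∞ H U
  energy_eq : ∀ v, legendre L v ∈ U → energy L v = H (legendre L v)

/-- `M = D²H ∘ ℱ + ∑_μ (D²φ_μ ∘ ℱ) λ^μ : TQ → Hom(T*Q, TQ)`. -/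
def opM {ι : Type*} [Fintype ι] (L : TangentBundle 𝓘(ℝ, E) Q → ℝ)
    (H : CotangentBundle E Q → ℝ) (φ : ι → CotangentBundle E Q → ℝ)
    (lam : ι → TangentBundle 𝓘(ℝ, E) Q → ℝ) (v : TangentBundle 𝓘(ℝ, E) Q) :
    CotangentSpace E v.1 →L[ℝ] TangentSpace 𝓘(ℝ, E) v.1 :=
  D2CoT H (legendre L v) + ∑ μ, lam μ v • D2CoT (φ μ) (legendre L v)

end Lagrangian

end FibreDer

end

open FibreDer

/-!
Differentiating `E = H ∘ ℱ` along the fibre in the direction `b` gives `⟨W(v) b, v - γ_H(v)⟩ = 0`: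
the image of `W(v)` annihilates `v - γ_H(v)`. A covector `y` that annihilates all the `γ_μ(v)` is,
as a vertical vector at `ℱ(v)`, killed by every `dφ_μ`, so it is tangent to `ℱ(TQ)` and, `ℱ` being
a submersion, the image of a tangent vector, which is vertical because `ℱ` covers the identity
of `Q`; hence `y` lies in the image of `W(v)` and annihilates `v - γ_H(v)` as well. Thus
`v - γ_H(v)` is a combination of the `γ_μ(v)`. These are linearly independent: a combination of the
`dφ_μ` that kills the vertical vectors also kills the image of `dℱ`, which together with the
vertical vectors spans everything. So the coefficients are unique and smooth, and the second
identity is the fibre derivative of the first.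
-/

namespace FibreDer

section NormedSpace

variable {X V Y : Type*} [NormedAddCommGroup X] [NormedSpace ℝ X]
  [NormedAddCommGroup V] [NormedSpace ℝ V] [NormedAddCommGroup Y] [NormedSpace ℝ Y]
  {ι : Type*}

theorem surjective_pi_of_linearIndependent [Finite ι] {B : ι → X →L[ℝ] ℝ}
    (hB : LinearIndependent ℝ B) : Function.Surjective (ContinuousLinearMap.pi B) := by
  have hcoe : LinearIndependent ℝ fun μ => (B μ : X → ℝ) :=
    hB.map' (LinearMap.ltoFun ℝ X ℝ ℝ ∘ₗ ContinuousLinearMap.coeLM ℝ)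
      (LinearMap.ker_eq_bot_of_injective fun _ _ h => DFunLike.coe_injective h)
  have hrange : range (flip fun μ => (B μ : X → ℝ)) =
      (ContinuousLinearMap.pi B : X →ₗ[ℝ] ι → ℝ).range := rfl
  have hspan := span_flip_eq_top_iff_linearIndependent.2 hcoe
  rw [hrange, Submodule.span_eq] at hspan
  exact LinearMap.range_eq_top.1 hspan

theorem exists_eq_sum_smul_of_forall_dual [Fintype ι] {g : ι → V} {e : V}
    (h : ∀ y : V →L[ℝ] ℝ, (∀ μ, y (g μ) = 0) → y e = 0) : ∃ c : ι → ℝ, e = ∑ μ, c μ • g μ := by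
  let ev : V → (V →L[ℝ] ℝ) →ₗ[ℝ] ℝ := fun v => (ContinuousLinearMap.apply ℝ ℝ v).toLinearMap
  have hspan : ev e ∈ Submodule.span ℝ (range fun μ => ev (g μ)) :=
    mem_span_of_iInf_ker_le_ker fun y hy => h y fun μ => (Submodule.mem_iInf _).1 hy μ
  obtain ⟨c, hc⟩ := (Submodule.mem_span_range_iff_exists_fun ℝ).1 hspan
  refine ⟨c, (SeparatingDual.eq_iff_forall_dual_eq (R := ℝ)).2 fun y => ?_⟩
  simpa [ev] using (LinearMap.congr_fun hc y).symm

theorem linearIndependent_comp_inr {T : X × V →L[ℝ] X × Y} {B : ι → X × Y →L[ℝ] ℝ}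
    (hB : LinearIndependent ℝ B) (hT : ∀ z, (T z).1 = z.1) (hBT : ∀ μ z, B μ (T z) = 0) :
    LinearIndependent ℝ fun μ => B μ ∘L ContinuousLinearMap.inr ℝ X Y := by
  refine hB.map (f := ((ContinuousLinearMap.inr ℝ X Y).precomp ℝ).toLinearMap)
    (Submodule.disjoint_def.2 fun C hC hC0 => ?_)
  have hspan : Submodule.span ℝ (range B) ≤ (T.precomp ℝ).toLinearMap.ker :=
    Submodule.span_le.2 (range_subset_iff.2 fun μ => ContinuousLinearMap.ext (hBT μ))
  have hCT : C ∘L T = 0 := hspan hC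
  ext z
  · have hz : ((z, 0) : X × Y) = T (z, 0) - (0, (T (z, 0)).2) := by ext <;> simp [hT]
    have h1 : C (T (z, 0)) = 0 := DFunLike.congr_fun hCT (z, 0)
    have h2 : C (0, (T (z, 0)).2) = 0 := DFunLike.congr_fun hC0 (T (z, 0)).2
    change C (z, 0) = 0
    rw [hz, map_sub, h1, h2, sub_zero]
  · exact DFunLike.congr_fun hC0 z

theorem hasFDerivAt_comp_add_sum_smul_comp [Fintype ι] {ℓ : X → Y} {W : X →L[ℝ] Y}
    {g₀ : Y → X} {g₀' : Y →L[ℝ] X} {g : ι → Y → X} {g' : ι → Y →L[ℝ] X} {lam : ι → X → ℝ}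
    {lam' : ι → X →L[ℝ] ℝ} {u : X} (hℓ : HasFDerivAt ℓ W u) (hg₀ : HasFDerivAt g₀ g₀' (ℓ u))
    (hg : ∀ μ, HasFDerivAt (g μ) (g' μ) (ℓ u)) (hlam : ∀ μ, HasFDerivAt (lam μ) (lam' μ) u) :
    HasFDerivAt (fun w => g₀ (ℓ w) + ∑ μ, lam μ w • g μ (ℓ w))
      ((g₀' + ∑ μ, lam μ u • g' μ) ∘L W + ∑ μ, (lam' μ).smulRight (g μ (ℓ u))) u := by
  have hsum := (hg₀.comp u hℓ).add
    (HasFDerivAt.fun_sum (u := Finset.univ) fun μ _ => (hlam μ).fun_smul ((hg μ).comp u hℓ))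
  refine hsum.congr_fderiv (ContinuousLinearMap.ext fun b => ?_)
  simp [Finset.sum_add_distrib, add_assoc]

theorem exists_contDiffAt_curve_mem_zero_locus [CompleteSpace X] [FiniteDimensional ℝ Y]
    {Φ : X → Y} {x₀ w : X} (hΦ : ContDiffAt ℝ ∞ Φ x₀) (h0 : Φ x₀ = 0)
    (hsurj : Function.Surjective (fderiv ℝ Φ x₀)) (hw : fderiv ℝ Φ x₀ w = 0) :
    ∃ c : ℝ → X, ContDiffAt ℝ ∞ c 0 ∧ c 0 = x₀ ∧ HasDerivAt c w 0 ∧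
      ∀ᶠ t in 𝓝 (0 : ℝ), Φ (c t) = 0 := by
  have : CompleteSpace Y := FiniteDimensional.complete ℝ Y
  obtain ⟨R, hR⟩ := (fderiv ℝ Φ x₀).exists_rightInverse_of_surjective
    (LinearMap.range_eq_top.2 hsurj)
  let γ : ℝ × Y → X := fun z => x₀ + (z.1 • w + R z.2)
  have hγ₀ : γ (0, 0) = x₀ := by simp [γ]
  have hγ : HasFDerivAt γ ((ContinuousLinearMap.toSpanSingleton ℝ w).coprod R) (0, 0) :=
    ((ContinuousLinearMap.toSpanSingleton ℝ w).coprod R).hasFDerivAt.const_add x₀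
  have hΨ : ContDiffAt ℝ ∞ (Φ ∘ γ) (0, 0) :=
    ContDiffAt.comp (0, 0) (hγ₀.symm ▸ hΦ) (by fun_prop)
  have hΨ' : fderiv ℝ (Φ ∘ γ) (0, 0) =
      fderiv ℝ Φ x₀ ∘L (ContinuousLinearMap.toSpanSingleton ℝ w).coprod R :=
    (HasFDerivAt.comp (0, 0) (hγ₀.symm ▸ (hΦ.differentiableAt (by simp)).hasFDerivAt) hγ).fderiv
  have hΨ₂ : fderiv ℝ (Φ ∘ γ) (0, 0) ∘L .inr ℝ ℝ Y = .id ℝ Y := by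
    rw [hΨ', ContinuousLinearMap.comp_assoc, ContinuousLinearMap.coprod_comp_inr, hR]
  have hΨ₁ : fderiv ℝ (Φ ∘ γ) (0, 0) ∘L .inl ℝ ℝ Y = 0 := by
    ext
    simp [hΨ', hw]
  have hinv : (fderiv ℝ (Φ ∘ γ) (0, 0) ∘L .inr ℝ ℝ Y).IsInvertible :=
    ⟨.refl ℝ Y, hΨ₂.symm⟩
  let ψ := hΨ.implicitFunction (by simp) hinv
  have hψ₀ : ψ 0 = 0 := hΨ.implicitFunction_apply_self _ hinv
  have hψ : HasDerivAt ψ 0 0 := by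
    have h := (hΨ.hasStrictFDerivAt_implicitFunction (by simp) hinv).hasFDerivAt.hasDerivAt
    simpa [hΨ₁] using h
  have hΨ₀ : (Φ ∘ γ) (0, 0) = 0 := (congrArg Φ hγ₀).trans h0
  refine ⟨fun t => γ (t, ψ t), ?_, ?_, ?_, ?_⟩
  · have hψs : ContDiffAt ℝ ∞ ψ 0 := hΨ.contDiffAt_implicitFunction _ hinv
    fun_prop
  · simpa only [hψ₀] using hγ₀
  · have h := HasFDerivAt.comp_hasDerivAt_of_eq (0 : ℝ) hγ ((hasDerivAt_id (0 : ℝ)).prodMk hψ)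
      (by simp [hψ₀])
    simpa [Function.comp_def] using h
  · exact (hΨ.eventually_apply_implicitFunction _ hinv).mono fun t ht => ht.trans hΨ₀

theorem contMDiffAt_coeff_of_linearIndependent [Fintype ι] [FiniteDimensional ℝ V]
    {EM : Type*} [NormedAddCommGroup EM] [NormedSpace ℝ EM] {HM : Type*} [TopologicalSpace HM]
    {I : ModelWithCorners ℝ EM HM} {M : Type*} [TopologicalSpace M] [ChartedSpace HM M]
    {n : WithTop ℕ∞} {x₀ : M} {g : ι → M → V} {s : M → V} {lam : M → ι → ℝ}
    (hg : ∀ μ, ContMDiffAt I 𝓘(ℝ, V) n (g μ) x₀) (hs : ContMDiffAt I 𝓘(ℝ, V) n s x₀)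
    (hind : LinearIndependent ℝ fun μ => g μ x₀)
    (heq : ∀ᶠ x in 𝓝 x₀, s x = ∑ μ, lam x μ • g μ x) :
    ContMDiffAt I 𝓘(ℝ, ι → ℝ) n lam x₀ := by
  let G : (ι → V) →L[ℝ] (ι → ℝ) →L[ℝ] V := ∑ μ, ContinuousLinearMap.smulRightL ℝ (ι → ℝ) V
    (ContinuousLinearMap.proj μ) ∘L ContinuousLinearMap.proj μ
  have hGapp : ∀ x c, G x c = ∑ μ, c μ • x μ := fun x c => by simp [G]
  have hG : ContMDiffAt I 𝓘(ℝ, (ι → ℝ) →L[ℝ] V) n (fun x => G fun μ => g μ x) x₀ :=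
    G.contMDiff.contMDiffAt.comp x₀ (contMDiffAt_pi_space.2 hg)
  have hinj : Function.Injective (G fun μ => g μ x₀) := by
    rw [funext (hGapp fun μ => g μ x₀)]
    exact linearIndependent_iff_injective_fintypeLinearCombination.1 hind
  obtain ⟨P, hP⟩ := ContinuousLinearMap.HasLeftInverse.of_injective_of_finiteDimensional hinj
  let B : M → (ι → ℝ) →L[ℝ] ι → ℝ := fun x => P ∘L G fun μ => g μ x
  have hB : ContMDiffAt I 𝓘(ℝ, (ι → ℝ) →L[ℝ] ι → ℝ) n B x₀ := contMDiffAt_const.clm_comp hG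
  have hB0 : B x₀ = (ContinuousLinearEquiv.refl ℝ (ι → ℝ) : (ι → ℝ) →L[ℝ] ι → ℝ) :=
    ContinuousLinearMap.ext hP
  have hinv : ContMDiffAt I 𝓘(ℝ, ι → ℝ) n (fun x => (B x).inverse (P (s x))) x₀ := by
    have h : ContDiffAt ℝ n ContinuousLinearMap.inverse (B x₀) := hB0 ▸ contDiffAt_map_inverse _
    exact (h.contMDiffAt.comp x₀ hB).clm_apply (P.contMDiff.contMDiffAt.comp x₀ hs)
  have hnear : ∀ᶠ x in 𝓝 x₀, B x ∈ range ((↑) : ((ι → ℝ) ≃L[ℝ] ι → ℝ) → (ι → ℝ) →L[ℝ] ι → ℝ) :=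
    hB.continuousAt.eventually (hB0 ▸ ContinuousLinearEquiv.nhds _)
  refine hinv.congr_of_eventuallyEq ?_
  filter_upwards [heq, hnear] with x hx ⟨e, he⟩
  rw [hx, ← hGapp]
  change lam x = (B x).inverse (B x (lam x))
  rw [← he, ContinuousLinearMap.inverse_equiv]
  simp

end NormedSpace

section ZeroLocus

variable {E' : Type*} [NormedAddCommGroup E'] [NormedSpace ℝ E']
  {H' : Type*} [TopologicalSpace H'] {J : ModelWithCorners ℝ E' H'}
  {N : Type*} [TopologicalSpace N] [ChartedSpace H' N]

theorem mem_tangentTo_of_hasDerivAt {S : Set N} {c : ℝ → N} {p : N} {w : TangentSpace J p}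
    (hp : c 0 = p) (hc : ContMDiffAt 𝓘(ℝ, ℝ) J ∞ c 0)
    (hw : HasDerivAt (F := E') (extChartAt J p ∘ c) w 0) (hS : ∀ᶠ t in 𝓝 0, c t ∈ S) :
    w ∈ tangentTo J S p := by
  subst hp
  have h : HasMFDerivAt 𝓘(ℝ, ℝ) J c 0 (ContinuousLinearMap.toSpanSingleton ℝ w) :=
    ⟨hc.continuousAt, hw.hasFDerivAt.hasFDerivWithinAt⟩
  refine ⟨c, hc, hS, ?_⟩
  rw [h.mfderiv]
  exact congrArg _ (one_smul ℝ w)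

theorem hasFDerivAt_comp_extChartAt_symm [J.Boundaryless] {g : N → ℝ} {p : N}
    (hg : MDifferentiableAt J 𝓘(ℝ, ℝ) g p) :
    HasFDerivAt (g ∘ (extChartAt J p).symm) (mvfderiv J g p : E' →L[ℝ] ℝ) (extChartAt J p p) := by
  have h := hg.hasMFDerivAt.2
  rw [J.range_eq_univ] at h
  exact hasFDerivWithinAt_univ.1 h

theorem mem_tangentTo_of_mvfderiv_eq_zero [CompleteSpace E'] [J.Boundaryless] [IsManifold J ∞ N]
    {ι : Type*} [Finite ι] {φ : ι → N → ℝ} {S : Set N} {p : N} {w : TangentSpace J p}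
    (hφ : ∀ μ, ContMDiffAt J 𝓘(ℝ, ℝ) ∞ (φ μ) p)
    (hind : LinearIndependent ℝ fun μ => mvfderiv J (φ μ) p) (hp : ∀ μ, φ μ p = 0)
    (hS : ∀ᶠ x in 𝓝 p, (∀ μ, φ μ x = 0) → x ∈ S) (hw : ∀ μ, mvfderiv J (φ μ) p w = 0) :
    w ∈ tangentTo J S p := by
  have := Fintype.ofFinite ι
  have hsymm : ContMDiffAt 𝓘(ℝ, E') J ∞ (extChartAt J p).symm (extChartAt J p p) :=
    (contMDiffOn_extChartAt_symm p).contMDiffAt (extChartAt_target_mem_nhds p)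
  have hleft : (extChartAt J p).symm (extChartAt J p p) = p := extChartAt_to_inv p
  have hloc : ∀ μ, ContDiffAt ℝ ∞ (φ μ ∘ (extChartAt J p).symm) (extChartAt J p p) := fun μ =>
    ((hφ μ).comp_of_eq hsymm hleft).contDiffAt
  have hΦ := hasFDerivAt_pi.2 fun μ =>
    hasFDerivAt_comp_extChartAt_symm ((hφ μ).mdifferentiableAt (by simp))
  obtain ⟨c, hc, hc₀, hcw, hcφ⟩ := exists_contDiffAt_curve_mem_zero_locus (X := E') (w := w)
    (contDiffAt_pi.2 hloc) (funext fun μ => (congrArg (φ μ) hleft).trans (hp μ))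
    (hΦ.fderiv ▸ surjective_pi_of_linearIndependent (X := E') hind) (hΦ.fderiv ▸ funext hw)
  have hce : ContMDiffAt 𝓘(ℝ, ℝ) J ∞ ((extChartAt J p).symm ∘ c) 0 :=
    hsymm.comp_of_eq hc.contMDiffAt hc₀
  have hp₀ : ((extChartAt J p).symm ∘ c) 0 = p := (congrArg _ hc₀).trans hleft
  have htarget : ∀ᶠ t in 𝓝 0, c t ∈ (extChartAt J p).target :=
    hc.continuousAt.eventually_mem (hc₀ ▸ extChartAt_target_mem_nhds p)
  have hderiv : HasDerivAt (extChartAt J p ∘ (extChartAt J p).symm ∘ c) w 0 :=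
    hcw.congr_of_eventuallyEq (htarget.mono fun t ht => (extChartAt J p).right_inv ht)
  rw [← hp₀] at hS
  refine mem_tangentTo_of_hasDerivAt hp₀ hce hderiv ?_
  filter_upwards [hcφ, hce.continuousAt.eventually hS] with t ht htS
  exact htS (congrFun ht)

end ZeroLocus

section FiberBundle

theorem eventually_mem_baseSet_trivializationAt {B M : Type*} (F : Type*) (V : B → Type*)
    [TopologicalSpace B] [TopologicalSpace M] [TopologicalSpace F]
    [TopologicalSpace (TotalSpace F V)] [∀ b, TopologicalSpace (V b)] [FiberBundle F V]
    {f : M → B} {x₀ : M} (hf : ContinuousAt f x₀) :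
    ∀ᶠ x in 𝓝 x₀, f x ∈ (trivializationAt F V (f x₀)).baseSet :=
  hf ((trivializationAt F V (f x₀)).open_baseSet.mem_nhds (mem_baseSet_trivializationAt F V (f x₀)))

end FiberBundle

section VectorBundle

variable {EB : Type*} [NormedAddCommGroup EB] [NormedSpace ℝ EB]
  {HB : Type*} [TopologicalSpace HB] {IB : ModelWithCorners ℝ EB HB}
  {B : Type*} [TopologicalSpace B] [ChartedSpace HB B]
  {F : Type*} [NormedAddCommGroup F] [NormedSpace ℝ F]
  {V : B → Type*} [TopologicalSpace (TotalSpace F V)] [∀ b, TopologicalSpace (V b)]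
  [FiberBundle F V]

theorem hasMFDerivAt_proj (p : TotalSpace F V) :
    HasMFDerivAt (IB.prod 𝓘(ℝ, F)) IB (π F V) p (ContinuousLinearMap.fst ℝ EB F) := by
  refine ⟨(FiberBundle.continuous_proj F V).continuousAt, ?_⟩
  have hfst : HasFDerivWithinAt Prod.fst (.fst ℝ EB F) (range (IB.prod 𝓘(ℝ, F)))
      (extChartAt (IB.prod 𝓘(ℝ, F)) p p) := hasFDerivWithinAt_fst
  have hwritten : EqOn (writtenInExtChartAt (IB.prod 𝓘(ℝ, F)) IB p (π F V)) Prod.fst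
      (extChartAt (IB.prod 𝓘(ℝ, F)) p).target := by
    intro z hz
    have hz' := hz
    rw [FiberBundle.extChartAt_target] at hz'
    rw [writtenInExtChartAt, Function.comp_apply, Function.comp_apply, FiberBundle.extChartAt]
    exact (congrArg (extChartAt IB p.1) ((trivializationAt F V p.1).proj_symm_apply' hz'.1.2)).trans
      ((extChartAt IB p.1).right_inv hz'.1.1)
  exact hfst.congr_of_eventuallyEq
    (hwritten.eventuallyEq_of_mem (extChartAt_target_mem_nhdsWithin p))
    (hwritten (mem_extChartAt_target p))

variable [∀ b, AddCommGroup (V b)] [∀ b, Module ℝ (V b)] [VectorBundle ℝ F V]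
  {G : Type*} [NormedAddCommGroup G] [NormedSpace ℝ G]

theorem trivializationAt_mk_clm_eq (q : B) (A : G →L[ℝ] V q) (w : G) :
    trivializationAt F V q ⟨q, A w⟩ =
      (q, ((trivializationAt F V q).continuousLinearMapAt ℝ q ∘L A) w) := by
  have hq : q ∈ (trivializationAt F V q).baseSet := mem_baseSet_trivializationAt F V q
  ext
  · exact (trivializationAt F V q).coe_fst' hq
  · exact congrFun (Trivialization.coe_linearMapAt_of_mem _ hq).symm (A w)

theorem contMDiff_mk_clm {n : WithTop ℕ∞} (q : B) (A : G →L[ℝ] V q) :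
    ContMDiff 𝓘(ℝ, G) (IB.prod 𝓘(ℝ, F)) n (fun w => (⟨q, A w⟩ : TotalSpace F V)) := by
  intro w
  rw [contMDiffAt_totalSpace]
  refine ⟨contMDiffAt_const, ?_⟩
  simp only [trivializationAt_mk_clm_eq]
  exact ContinuousLinearMap.contMDiff _ w

theorem hasMFDerivAt_mk_clm (q : B) (A : G →L[ℝ] V q) (w : G) :
    HasMFDerivAt 𝓘(ℝ, G) (IB.prod 𝓘(ℝ, F)) (fun w => (⟨q, A w⟩ : TotalSpace F V)) w
      (.inr ℝ EB F ∘L (trivializationAt F V q).continuousLinearMapAt ℝ q ∘L A) := by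
  refine ⟨(contMDiff_mk_clm (IB := IB) (n := 0) q A).continuous.continuousAt, ?_⟩
  have hwritten : writtenInExtChartAt 𝓘(ℝ, G) (IB.prod 𝓘(ℝ, F)) w
      (fun w => (⟨q, A w⟩ : TotalSpace F V)) = fun w => (extChartAt IB q q,
        ((trivializationAt F V q).continuousLinearMapAt ℝ q ∘L A) w) := by
    ext1 w
    rw [writtenInExtChartAt, FiberBundle.extChartAt, extChartAt_model_space_eq_id]
    exact congrArg (Prod.map (extChartAt IB q) id) (trivializationAt_mk_clm_eq q A w)
  rw [hwritten]
  exact ((hasFDerivAt_const _ _).prodMk (ContinuousLinearMap.hasFDerivAt _)).hasFDerivWithinAt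

variable {Y : Type*} [NormedAddCommGroup Y] [NormedSpace ℝ Y]

theorem contDiffAt_comp_mk_clm {n : WithTop ℕ∞} {g : TotalSpace F V → Y} {q : B}
    (A : G →L[ℝ] V q) {w : G} (hg : ContMDiffAt (IB.prod 𝓘(ℝ, F)) 𝓘(ℝ, Y) n g ⟨q, A w⟩) :
    ContDiffAt ℝ n (fun w => g ⟨q, A w⟩) w :=
  (hg.comp w (contMDiff_mk_clm q A w)).contDiffAt

theorem contMDiffAt_fderiv_trivializationAt [IsManifold IB ∞ B]
    [ContMDiffVectorBundle ∞ F V IB] {g : TotalSpace F V → Y} {p₀ : TotalSpace F V}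
    (hg : ContMDiffAt (IB.prod 𝓘(ℝ, F)) 𝓘(ℝ, Y) ∞ g p₀) :
    ContMDiffAt (IB.prod 𝓘(ℝ, F)) 𝓘(ℝ, F →L[ℝ] Y) ∞ (fun p => fderiv ℝ
      (fun w => g ⟨p.1, (trivializationAt F V p₀.1).symm p.1 w⟩) (trivializationAt F V p₀.1 p).2)
      p₀ := by
  set e := trivializationAt F V p₀.1
  have hp₀ : p₀.1 ∈ e.baseSet := mem_baseSet_trivializationAt F V p₀.1
  have he : ContMDiffAt (IB.prod 𝓘(ℝ, F)) (IB.prod 𝓘(ℝ, F)) ∞ e p₀ :=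
    (e.contMDiffOn _ (e.mem_source.2 hp₀)).contMDiffAt (e.open_source.mem_nhds (e.mem_source.2 hp₀))
  have hsymm : ContMDiffAt ((IB.prod 𝓘(ℝ, F)).prod 𝓘(ℝ, F)) (IB.prod 𝓘(ℝ, F)) ∞
      (fun z : TotalSpace F V × F => (⟨z.1.1, e.symm z.1.1 z.2⟩ : TotalSpace F V))
      (p₀, (e p₀).2) := by
    have hproj : ContMDiff ((IB.prod 𝓘(ℝ, F)).prod 𝓘(ℝ, F)) IB ∞
        fun z : TotalSpace F V × F => z.1.1 := (contMDiff_proj V).comp contMDiff_fst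
    rw [e.contMDiffAt_iff (e.mem_source.2 hp₀)]
    refine ⟨hproj _, contMDiffAt_snd.congr_of_eventuallyEq ?_⟩
    filter_upwards [eventually_mem_baseSet_trivializationAt F V hproj.continuous.continuousAt]
      with z hz
    exact congrArg Prod.snd (e.apply_mk_symm hz z.2)
  have hsymm₀ : (⟨p₀.1, e.symm p₀.1 (e p₀).2⟩ : TotalSpace F V) = p₀ := by
    rw [e.symm_proj_apply p₀ hp₀]
  have h := ContMDiffAt.mfderiv (fun p w => g ⟨p.1, e.symm p.1 w⟩) (fun p => (e p).2)
    (hg.comp_of_eq hsymm hsymm₀) (contMDiffAt_snd.comp p₀ he) le_rfl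
  simpa only [inTangentCoordinates_model_space, mfderiv_eq_fderiv] using h

variable {EM : Type*} [NormedAddCommGroup EM] [NormedSpace ℝ EM]
  {HM : Type*} [TopologicalSpace HM] {I : ModelWithCorners ℝ EM HM}
  {M : Type*} [TopologicalSpace M] [ChartedSpace HM M] {n : WithTop ℕ∞} {x₀ : M} {f : M → B}

theorem contMDiffAt_mk_sub {s t : ∀ x, V (f x)}
    (hs : ContMDiffAt I (IB.prod 𝓘(ℝ, F)) n (fun x => (⟨f x, s x⟩ : TotalSpace F V)) x₀)
    (ht : ContMDiffAt I (IB.prod 𝓘(ℝ, F)) n (fun x => (⟨f x, t x⟩ : TotalSpace F V)) x₀) :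
    ContMDiffAt I (IB.prod 𝓘(ℝ, F)) n (fun x => (⟨f x, s x - t x⟩ : TotalSpace F V)) x₀ := by
  rw [contMDiffAt_totalSpace] at hs ht ⊢
  refine ⟨hs.1, (hs.2.sub ht.2).congr_of_eventuallyEq ?_⟩
  filter_upwards [eventually_mem_baseSet_trivializationAt F V hs.1.continuousAt] with x hx
  exact map_sub ((trivializationAt F V (f x₀)).continuousLinearEquivAt ℝ (f x) hx) (s x) (t x)

theorem contMDiffAt_coeff_of_linearIndependent_section [FiniteDimensional ℝ F]
    {ι : Type*} [Fintype ι] {g : ι → ∀ x, V (f x)} {s : ∀ x, V (f x)} {lam : M → ι → ℝ}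
    (hg : ∀ μ, ContMDiffAt I (IB.prod 𝓘(ℝ, F)) n (fun x => (⟨f x, g μ x⟩ : TotalSpace F V)) x₀)
    (hs : ContMDiffAt I (IB.prod 𝓘(ℝ, F)) n (fun x => (⟨f x, s x⟩ : TotalSpace F V)) x₀)
    (hind : LinearIndependent ℝ fun μ => g μ x₀)
    (heq : ∀ᶠ x in 𝓝 x₀, s x = ∑ μ, lam x μ • g μ x) :
    ContMDiffAt I 𝓘(ℝ, ι → ℝ) n lam x₀ := by
  simp only [contMDiffAt_totalSpace] at hg hs
  set e := trivializationAt F V (f x₀)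
  have hbase : ∀ᶠ x in 𝓝 x₀, f x ∈ e.baseSet :=
    eventually_mem_baseSet_trivializationAt F V hs.1.continuousAt
  have he : ∀ x (hx : f x ∈ e.baseSet) (v : V (f x)),
      (e ⟨f x, v⟩).2 = e.continuousLinearEquivAt ℝ (f x) hx v := fun _ _ _ => rfl
  refine contMDiffAt_coeff_of_linearIndependent (fun μ => (hg μ).2) hs.2 ?_ ?_
  · exact hind.map' (e.continuousLinearEquivAt ℝ (f x₀) hbase.self_of_nhds).toLinearMap
      (LinearEquiv.ker _)
  · filter_upwards [heq, hbase] with x hx hxb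
    simp only [he x hxb, hx, map_sum, map_smul]

end VectorBundle

section DualGradient

variable {V : Type*} [NormedAddCommGroup V] [NormedSpace ℝ V] [FiniteDimensional ℝ V]

/-- The gradient of a function on a dual space, as a vector of the space itself through the
identification of the space with its bidual. It is the fibre derivative `DCoT` on one fibre. -/
noncomputable def dualGradient (h : (V →L[ℝ] ℝ) → ℝ) (a : V →L[ℝ] ℝ) : V :=
  (bidualEquiv V).symm (fderiv ℝ h a)

theorem contDiff_bidualEquiv_symm {n : WithTop ℕ∞} : ContDiff ℝ n (bidualEquiv V).symm :=
  -- Instance search for the norm of the bidual times out, hence the explicit instances.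
  @ContinuousLinearEquiv.contDiff ℝ ((V →L[ℝ] ℝ) →L[ℝ] ℝ) V _
    ContinuousLinearMap.toNormedAddCommGroup ContinuousLinearMap.toNormedSpace _ _ _
    (bidualEquiv V).symm

theorem apply_dualGradient (h : (V →L[ℝ] ℝ) → ℝ) (a b : V →L[ℝ] ℝ) :
    b (dualGradient h a) = fderiv ℝ h a b := by
  rw [dualGradient, ← bidualEquiv_apply, ContinuousLinearEquiv.apply_symm_apply]

theorem map_dualGradient {W : Type*} [NormedAddCommGroup W] [NormedSpace ℝ W]
    [FiniteDimensional ℝ W] (A : V ≃L[ℝ] W) (h : (V →L[ℝ] ℝ) → ℝ) (a : V →L[ℝ] ℝ) :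
    A (dualGradient h a) =
      dualGradient (fun b => h (b ∘L (A : V →L[ℝ] W))) (a ∘L (A.symm : W →L[ℝ] V)) := by
  refine (SeparatingDual.eq_iff_forall_dual_eq (R := ℝ)).2 fun b => ?_
  have hcomp := (A.arrowCongr (.refl ℝ ℝ)).symm.comp_right_fderiv (f := h)
    (x := a ∘L (A.symm : W →L[ℝ] V))
  have ha : (A.arrowCongr (.refl ℝ ℝ)).symm (a ∘L (A.symm : W →L[ℝ] V)) = a := by
    ext
    simp
  rw [ha] at hcomp
  rw [apply_dualGradient]
  refine .trans ?_ (DFunLike.congr_fun hcomp b).symm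
  exact apply_dualGradient h a (b ∘L (A : V →L[ℝ] W))

theorem fderiv_fderiv_apply_sub_dualGradient_eq_zero {ℓ : V → ℝ} {H : (V →L[ℝ] ℝ) → ℝ} {u : V}
    (hℓ : ContDiffAt ℝ 2 ℓ u) (hH : DifferentiableAt ℝ H (fderiv ℝ ℓ u))
    (heq : ∀ᶠ w in 𝓝 u, fderiv ℝ ℓ w w - ℓ w = H (fderiv ℝ ℓ w)) (b : V) :
    fderiv ℝ (fderiv ℝ ℓ) u b (u - dualGradient H (fderiv ℝ ℓ u)) = 0 := by
  have hW : HasFDerivAt (fderiv ℝ ℓ) (fderiv ℝ (fderiv ℝ ℓ) u) u :=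
    ((hℓ.fderiv_right (m := 1) le_rfl).differentiableAt one_ne_zero).hasFDerivAt
  have henergy := (hW.clm_apply (hasFDerivAt_id u)).sub
    (hℓ.differentiableAt two_ne_zero).hasFDerivAt
  have hcomp := (hH.hasFDerivAt.comp u hW).congr_of_eventuallyEq heq
  have h := DFunLike.congr_fun (henergy.unique hcomp) b
  rw [map_sub, apply_dualGradient]
  simpa [sub_eq_zero] using h

end DualGradient

section Tangent

variable {E : Type*} [NormedAddCommGroup E] [NormedSpace ℝ E]
  {Q : Type*} [TopologicalSpace Q] [ChartedSpace E Q] [IsManifold 𝓘(ℝ, E) ∞ Q]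

theorem DT_comp_symmL (g : TangentBundle 𝓘(ℝ, E) Q → ℝ) {q : Q} {v : TangentBundle 𝓘(ℝ, E) Q}
    (hv : v.1 ∈ (trivializationAt E (TangentSpace 𝓘(ℝ, E)) q).baseSet) :
    DT g v ∘L (trivializationAt E (TangentSpace 𝓘(ℝ, E)) q).symmL ℝ v.1 =
      fderiv ℝ (fun w => g ⟨v.1, (trivializationAt E (TangentSpace 𝓘(ℝ, E)) q).symm v.1 w⟩)
        (trivializationAt E (TangentSpace 𝓘(ℝ, E)) q v).2 := by
  let e := trivializationAt E (TangentSpace 𝓘(ℝ, E)) q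
  let A : E ≃L[ℝ] E := (e.continuousLinearEquivAt ℝ v.1 hv).symm
  have hA : A (e v).2 = v.2 := e.symm_proj_apply v hv
  have h := A.comp_right_fderiv (f := fun w : E => g ⟨v.1, w⟩) (x := (e v).2)
  rw [hA] at h
  rw [← Trivialization.symm_continuousLinearEquivAt_eq' _ hv]
  exact h.symm

theorem contMDiffAt_legendre {L : TangentBundle 𝓘(ℝ, E) Q → ℝ} {v : TangentBundle 𝓘(ℝ, E) Q}
    (hL : ContMDiffAt (modelT E) 𝓘(ℝ, ℝ) ∞ L v) :
    ContMDiffAt (modelT E) (modelCoT E) ∞ (legendre L) v := by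
  refine (contMDiffAt_hom_bundle _).2 ⟨(contMDiff_proj _).contMDiffAt, ?_⟩
  refine (contMDiffAt_fderiv_trivializationAt hL).congr_of_eventuallyEq ?_
  filter_upwards [eventually_mem_baseSet_trivializationAt E (TangentSpace 𝓘(ℝ, E))
    (FiberBundle.continuous_proj E _).continuousAt] with w hw
  refine Eq.trans ?_ (DT_comp_symmL L hw)
  simp [ContinuousLinearMap.inCoordinates, legendre]

theorem cotangent_trivializationAt_snd {q : Q} (p : CotangentBundle E Q) :
    (trivializationAt (E →L[ℝ] ℝ) (CotangentSpace E) q p).2 =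
      p.2 ∘L (trivializationAt E (TangentSpace 𝓘(ℝ, E)) q).symmL ℝ p.1 := by
  have h := hom_trivializationAt_apply (RingHom.id ℝ) (F₁ := E)
    (E₁ := fun q : Q => TangentSpace 𝓘(ℝ, E) q) (F₂ := ℝ) (E₂ := fun _ : Q => ℝ) q p
  simpa [ContinuousLinearMap.inCoordinates] using congrArg Prod.snd h

theorem cotangent_trivializationAt_symm {q x : Q}
    (hx : x ∈ (trivializationAt E (TangentSpace 𝓘(ℝ, E)) q).baseSet) (a : E →L[ℝ] ℝ) :
    (trivializationAt (E →L[ℝ] ℝ) (CotangentSpace E) q).symm x a =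
      a ∘L (trivializationAt E (TangentSpace 𝓘(ℝ, E)) q).continuousLinearMapAt ℝ x := by
  have hx' : x ∈ (trivializationAt (E →L[ℝ] ℝ) (CotangentSpace E) q).baseSet :=
    ⟨hx, mem_univ _⟩
  rw [← Trivialization.symm_apply_apply_mk _ hx' (a ∘L _)]
  congr 1
  rw [cotangent_trivializationAt_snd]
  ext w
  exact congrArg a (Trivialization.continuousLinearMapAt_symmL _ hx w).symm

theorem hasMFDerivAt_mk_tangentSpace (q : Q) (u : E) :
    HasMFDerivAt 𝓘(ℝ, E) (modelT E) (fun w : E => (⟨q, w⟩ : TangentBundle 𝓘(ℝ, E) Q)) u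
      (.inr ℝ E E) := by
  have h := hasMFDerivAt_mk_clm (IB := 𝓘(ℝ, E)) (F := E) (V := TangentSpace 𝓘(ℝ, E)) (G := E) q
    (.id ℝ E) u
  refine h.congr_mfderiv (ContinuousLinearMap.ext fun w => ?_)
  rw [TangentBundle.continuousLinearMapAt_trivializationAt_eq_core (mem_chart_source E q)]
  refine congrArg (Prod.mk 0) ?_
  exact (tangentBundleCore 𝓘(ℝ, E) Q).coordChange_self _ _ (mem_achart_source E q) w

theorem hasMFDerivAt_mk_cotangentSpace (q : Q) (a : E →L[ℝ] ℝ) :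
    HasMFDerivAt 𝓘(ℝ, E →L[ℝ] ℝ) (modelCoT E)
      (fun b : E →L[ℝ] ℝ => (⟨q, b⟩ : CotangentBundle E Q)) a (.inr ℝ E (E →L[ℝ] ℝ)) := by
  have h := hasMFDerivAt_mk_clm (IB := 𝓘(ℝ, E)) (F := E →L[ℝ] ℝ) (V := CotangentSpace E)
    (G := E →L[ℝ] ℝ) q (.id ℝ (E →L[ℝ] ℝ)) a
  refine h.congr_mfderiv (ContinuousLinearMap.ext fun b => congrArg (Prod.mk 0) ?_)
  have hb : ((trivializationAt (E →L[ℝ] ℝ) (CotangentSpace E) q).continuousLinearMapAt ℝ q) b =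
      b ∘L (trivializationAt E (TangentSpace 𝓘(ℝ, E)) q).symmL ℝ q :=
    (congrFun (Trivialization.coe_linearMapAt_of_mem _
      (mem_baseSet_trivializationAt (E →L[ℝ] ℝ) (CotangentSpace E) q)) b).trans
      (cotangent_trivializationAt_snd (⟨q, b⟩ : CotangentBundle E Q))
  refine hb.trans (ContinuousLinearMap.ext fun w => ?_)
  rw [TangentBundle.symmL_trivializationAt_eq_core (mem_chart_source E q)]
  exact congrArg (show E →L[ℝ] ℝ from b)
    ((tangentBundleCore 𝓘(ℝ, E) Q).coordChange_self _ _ (mem_achart_source E q) w)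

theorem contDiffAt_tangentSpace {Y : Type*} [NormedAddCommGroup Y] [NormedSpace ℝ Y]
    {n : WithTop ℕ∞} {g : TangentBundle 𝓘(ℝ, E) Q → Y} {v : TangentBundle 𝓘(ℝ, E) Q}
    (hg : ContMDiffAt (modelT E) 𝓘(ℝ, Y) n g v) :
    ContDiffAt ℝ n (fun w : E => g ⟨v.1, w⟩) v.2 :=
  contDiffAt_comp_mk_clm (G := E) (V := TangentSpace 𝓘(ℝ, E)) (.id ℝ E) hg

theorem contDiffAt_cotangentSpace {Y : Type*} [NormedAddCommGroup Y] [NormedSpace ℝ Y]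
    {n : WithTop ℕ∞} {h : CotangentBundle E Q → Y} {p : CotangentBundle E Q}
    (hh : ContMDiffAt (modelCoT E) 𝓘(ℝ, Y) n h p) :
    ContDiffAt ℝ n (fun a : E →L[ℝ] ℝ => h ⟨p.1, a⟩) p.2 :=
  contDiffAt_comp_mk_clm (G := E →L[ℝ] ℝ) (V := CotangentSpace E) (.id ℝ (E →L[ℝ] ℝ)) hh

variable {L : TangentBundle 𝓘(ℝ, E) Q → ℝ} {v : TangentBundle 𝓘(ℝ, E) Q}

theorem hasFDerivAt_DT (hL : ContMDiffAt (modelT E) 𝓘(ℝ, ℝ) ∞ L v) :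
    HasFDerivAt (E := E) (F := E →L[ℝ] ℝ) (fun w : E => DT L ⟨v.1, w⟩) (hessian L v) v.2 := by
  have h : ContDiffAt ℝ ∞ (fun w : E => L ⟨v.1, w⟩) v.2 := contDiffAt_tangentSpace hL
  exact ((h.fderiv_right (m := ∞) (by simp)).differentiableAt (by simp)).hasFDerivAt

theorem exists_hasMFDerivAt_legendre (hL : ContMDiffAt (modelT E) 𝓘(ℝ, ℝ) ∞ L v) :
    ∃ T : E × E →L[ℝ] E × (E →L[ℝ] ℝ),
      HasMFDerivAt (modelT E) (modelCoT E) (legendre L) v T ∧ (∀ z, (T z).1 = z.1) ∧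
        ∀ b, T (0, b) = (0, hessian L v b) := by
  have hT := ((contMDiffAt_legendre hL).mdifferentiableAt (by simp)).hasMFDerivAt
  refine ⟨_, hT, fun z => ?_, fun b => ?_⟩
  · have hproj := (hasMFDerivAt_proj (IB := 𝓘(ℝ, E)) (legendre L v)).comp v hT
    exact DFunLike.congr_fun
      (hasMFDerivAt_unique hproj (hasMFDerivAt_proj (IB := 𝓘(ℝ, E)) v)) z
  · have hfibre := hT.comp (M := E) (I := 𝓘(ℝ, E)) (v.2 : E)
      (hasMFDerivAt_mk_tangentSpace (E := E) v.1 v.2)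
    have hfibre' := (hasMFDerivAt_mk_cotangentSpace (E := E) v.1 (DT L v)).comp (M := E)
      (I := 𝓘(ℝ, E)) (v.2 : E) (hasFDerivAt_DT hL).hasMFDerivAt
    exact DFunLike.congr_fun (hasMFDerivAt_unique hfibre hfibre') b

theorem exists_hessian_apply_eq (hL : ContMDiffAt (modelT E) 𝓘(ℝ, ℝ) ∞ L v) {y : E →L[ℝ] ℝ}
    (hy : ((0, y) : E × (E →L[ℝ] ℝ)) ∈ range (mfderiv (modelT E) (modelCoT E) (legendre L) v)) :
    ∃ b, hessian L v b = y := by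
  obtain ⟨T, hT, hT₁, hT₂⟩ := exists_hasMFDerivAt_legendre hL
  rw [hT.mfderiv] at hy
  obtain ⟨⟨a, b⟩, hab⟩ := hy
  obtain rfl : a = 0 := (hT₁ (a, b)).symm.trans (congrArg Prod.fst hab)
  exact ⟨b, congrArg Prod.snd ((hT₂ b).symm.trans hab)⟩

variable [FiniteDimensional ℝ E]

theorem trivializationAt_DCoT (h : CotangentBundle E Q → ℝ) {q : Q} {p : CotangentBundle E Q}
    (hp : p.1 ∈ (trivializationAt E (TangentSpace 𝓘(ℝ, E)) q).baseSet) :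
    (trivializationAt E (TangentSpace 𝓘(ℝ, E)) q ⟨p.1, DCoT h p⟩).2 =
      dualGradient
        (fun a => h ⟨p.1, (trivializationAt (E →L[ℝ] ℝ) (CotangentSpace E) q).symm p.1 a⟩)
        (trivializationAt (E →L[ℝ] ℝ) (CotangentSpace E) q p).2 := by
  let A : E ≃L[ℝ] E :=
    (trivializationAt E (TangentSpace 𝓘(ℝ, E)) q).continuousLinearEquivAt ℝ p.1 hp
  refine (map_dualGradient A (fun a : E →L[ℝ] ℝ => h ⟨p.1, a⟩) p.2).trans ?_
  simp only [cotangent_trivializationAt_symm hp]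
  rw [cotangent_trivializationAt_snd, ← Trivialization.symm_continuousLinearEquivAt_eq' _ hp,
    ← Trivialization.coe_continuousLinearEquivAt_eq' _ hp]
  rfl

theorem contMDiffAt_DCoT {h : CotangentBundle E Q → ℝ} {p : CotangentBundle E Q}
    (hh : ContMDiffAt (modelCoT E) 𝓘(ℝ, ℝ) ∞ h p) :
    ContMDiffAt (modelCoT E) (modelT E) ∞
      (fun p => (⟨p.1, DCoT h p⟩ : TangentBundle 𝓘(ℝ, E) Q)) p := by
  refine contMDiffAt_totalSpace.2 ⟨(contMDiff_proj _).contMDiffAt, ?_⟩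
  refine (contDiff_bidualEquiv_symm.contMDiff.contMDiffAt.comp p
    (contMDiffAt_fderiv_trivializationAt hh)).congr_of_eventuallyEq ?_
  filter_upwards [eventually_mem_baseSet_trivializationAt E (TangentSpace 𝓘(ℝ, E))
    (FiberBundle.continuous_proj _ _).continuousAt]
    with p' hp'
  exact trivializationAt_DCoT h hp'

theorem mvfderiv_apply_inr {h : CotangentBundle E Q → ℝ} {p : CotangentBundle E Q}
    (hh : ContMDiffAt (modelCoT E) 𝓘(ℝ, ℝ) ∞ h p) (a : E →L[ℝ] ℝ) :
    mvfderiv (modelCoT E) h p ((0, a) : E × (E →L[ℝ] ℝ)) = a (DCoT h p) := by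
  have hfibre := (hh.mdifferentiableAt (by simp)).hasMFDerivAt.comp (M := E →L[ℝ] ℝ)
    (I := 𝓘(ℝ, E →L[ℝ] ℝ)) (p.2 : E →L[ℝ] ℝ) (hasMFDerivAt_mk_cotangentSpace (E := E) p.1 p.2)
  have hfibre' := ((contDiffAt_cotangentSpace hh).differentiableAt (by simp)).hasFDerivAt
  exact (DFunLike.congr_fun (hasMFDerivAt_unique hfibre hfibre'.hasMFDerivAt) a).trans
    (apply_dualGradient (fun a : E →L[ℝ] ℝ => h ⟨p.1, a⟩) p.2 a).symm

theorem hessian_apply_sub_gam_eq_zero {H : CotangentBundle E Q → ℝ}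
    (hL : ContMDiffAt (modelT E) 𝓘(ℝ, ℝ) ∞ L v)
    (hH : ContMDiffAt (modelCoT E) 𝓘(ℝ, ℝ) ∞ H (legendre L v))
    (heq : ∀ᶠ w in 𝓝 v, energy L w = H (legendre L w)) (b : TangentSpace 𝓘(ℝ, E) v.1) :
    hessian L v b (v.2 - gam L H v) = 0 := by
  have hfibre := (hasMFDerivAt_mk_tangentSpace (E := E) v.1 v.2).continuousAt
  exact fderiv_fderiv_apply_sub_dualGradient_eq_zero (V := E) (ℓ := fun w : E => L ⟨v.1, w⟩)
    ((contDiffAt_tangentSpace hL).of_le ENat.LEInfty.out)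
    ((contDiffAt_cotangentSpace hH).differentiableAt (by simp)) (hfibre.eventually heq) b

variable {ι : Type*} {φ : ι → CotangentBundle E Q → ℝ}

theorem linearIndependent_gam (hL : ContMDiffAt (modelT E) 𝓘(ℝ, ℝ) ∞ L v)
    (hφ : ∀ μ, ContMDiffAt (modelCoT E) 𝓘(ℝ, ℝ) ∞ (φ μ) (legendre L v))
    (hind : LinearIndependent ℝ fun μ => mvfderiv (modelCoT E) (φ μ) (legendre L v))
    (hzero : ∀ᶠ w in 𝓝 v, ∀ μ, φ μ (legendre L w) = 0) :
    LinearIndependent ℝ fun μ => gam L (φ μ) v := by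
  obtain ⟨T, hT, hT₁, -⟩ := exists_hasMFDerivAt_legendre hL
  have hφT : ∀ μ z, mvfderiv (modelCoT E) (φ μ) (legendre L v) (T z) = 0 := fun μ z => by
    have hcomp := ((hφ μ).mdifferentiableAt (by simp)).hasMFDerivAt.comp v hT
    have hconst : HasMFDerivAt (modelT E) 𝓘(ℝ, ℝ) (φ μ ∘ legendre L) v 0 :=
      (hasMFDerivAt_const (0 : ℝ) v).congr_of_eventuallyEq (hzero.mono fun w hw => hw μ)
    exact DFunLike.congr_fun (hasMFDerivAt_unique hcomp hconst) z
  have hfibre := linearIndependent_comp_inr (X := E) (V := E) (Y := E →L[ℝ] ℝ) hind hT₁ hφT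
  refine LinearIndependent.of_comp (bidualEquiv E).toLinearMap ?_
  convert hfibre using 2 with μ
  exact ContinuousLinearMap.ext fun a => (mvfderiv_apply_inr (hφ μ) a).symm

theorem exists_eq_gam_add_sum_smul_gam [Fintype ι] {H : CotangentBundle E Q → ℝ}
    (hL : ContMDiffAt (modelT E) 𝓘(ℝ, ℝ) ∞ L v)
    (hsub : tangentTo (modelCoT E) (range (legendre L)) (legendre L v) ⊆
      range (mfderiv (modelT E) (modelCoT E) (legendre L) v))
    (hφ : ∀ μ, ContMDiffAt (modelCoT E) 𝓘(ℝ, ℝ) ∞ (φ μ) (legendre L v))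
    (hind : LinearIndependent ℝ fun μ => mvfderiv (modelCoT E) (φ μ) (legendre L v))
    (hzero : ∀ μ, φ μ (legendre L v) = 0)
    (hrange : ∀ᶠ p in 𝓝 (legendre L v), (∀ μ, φ μ p = 0) → p ∈ range (legendre L))
    (hH : ContMDiffAt (modelCoT E) 𝓘(ℝ, ℝ) ∞ H (legendre L v))
    (heq : ∀ᶠ w in 𝓝 v, energy L w = H (legendre L w)) :
    ∃ c : ι → ℝ, v.2 = gam L H v + ∑ μ, c μ • gam L (φ μ) v := by
  have : CompleteSpace E := FiniteDimensional.complete ℝ E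
  have hdual : ∀ y : E →L[ℝ] ℝ, (∀ μ, y (gam L (φ μ) v) = 0) → y (v.2 - gam L H v) = 0 := by
    intro y hy
    have htangent := mem_tangentTo_of_mvfderiv_eq_zero (E' := E × (E →L[ℝ] ℝ)) (w := (0, y))
      hφ hind hzero hrange fun μ => (mvfderiv_apply_inr (hφ μ) y).trans (hy μ)
    obtain ⟨b, rfl⟩ := exists_hessian_apply_eq hL (hsub htangent)
    exact hessian_apply_sub_gam_eq_zero hL hH heq b
  obtain ⟨c, hc⟩ := exists_eq_sum_smul_of_forall_dual hdual
  exact ⟨c, sub_eq_iff_eq_add'.1 hc⟩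

theorem hasFDerivAt_DCoT {h : CotangentBundle E Q → ℝ} {p : CotangentBundle E Q}
    (hh : ContMDiffAt (modelCoT E) 𝓘(ℝ, ℝ) ∞ h p) :
    HasFDerivAt (E := E →L[ℝ] ℝ) (F := E) (fun a : E →L[ℝ] ℝ => DCoT h ⟨p.1, a⟩) (D2CoT h p)
      p.2 := by
  have hh' : ContDiffAt ℝ ∞ (fun a : E →L[ℝ] ℝ => h ⟨p.1, a⟩) p.2 := contDiffAt_cotangentSpace hh
  have hgrad : ContDiffAt ℝ ∞ (dualGradient fun a : E →L[ℝ] ℝ => h ⟨p.1, a⟩) p.2 :=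
    contDiff_bidualEquiv_symm.contDiffAt.comp _ (hh'.fderiv_right (m := ∞) (by simp))
  exact (hgrad.differentiableAt (by simp)).hasFDerivAt

theorem contMDiffAt_gam {h : CotangentBundle E Q → ℝ} (hL : ContMDiffAt (modelT E) 𝓘(ℝ, ℝ) ∞ L v)
    (hh : ContMDiffAt (modelCoT E) 𝓘(ℝ, ℝ) ∞ h (legendre L v)) :
    ContMDiffAt (modelT E) (modelT E) ∞
      (fun v => (⟨v.1, gam L h v⟩ : TangentBundle 𝓘(ℝ, E) Q)) v :=
  (contMDiffAt_DCoT hh).comp v (contMDiffAt_legendre hL)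

section Multipliers

variable [Fintype ι] {H : CotangentBundle E Q → ℝ} {lam : ι → TangentBundle 𝓘(ℝ, E) Q → ℝ}

theorem contMDiffAt_of_eq_gam_add_sum_smul_gam (hL : ContMDiffAt (modelT E) 𝓘(ℝ, ℝ) ∞ L v)
    (hH : ContMDiffAt (modelCoT E) 𝓘(ℝ, ℝ) ∞ H (legendre L v))
    (hφ : ∀ μ, ContMDiffAt (modelCoT E) 𝓘(ℝ, ℝ) ∞ (φ μ) (legendre L v))
    (hind : LinearIndependent ℝ fun μ => gam L (φ μ) v)
    (heq : ∀ᶠ w in 𝓝 v, w.2 = gam L H w + ∑ μ, lam μ w • gam L (φ μ) w) (μ : ι) :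
    ContMDiffAt (modelT E) 𝓘(ℝ, ℝ) ∞ (lam μ) v := by
  have hlam : ContMDiffAt (modelT E) 𝓘(ℝ, ι → ℝ) ∞ (fun w μ => lam μ w) v :=
    contMDiffAt_coeff_of_linearIndependent_section (IB := 𝓘(ℝ, E)) (F := E)
      (V := TangentSpace 𝓘(ℝ, E)) (fun μ => contMDiffAt_gam hL (hφ μ))
      (contMDiffAt_mk_sub contMDiffAt_id (contMDiffAt_gam hL hH)) hind
      (heq.mono fun w hw => sub_eq_iff_eq_add'.2 hw)
  exact contMDiffAt_pi_space.1 hlam μ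

theorem id_eq_opM_comp_hessian_add_sum (hL : ContMDiffAt (modelT E) 𝓘(ℝ, ℝ) ∞ L v)
    (hH : ContMDiffAt (modelCoT E) 𝓘(ℝ, ℝ) ∞ H (legendre L v))
    (hφ : ∀ μ, ContMDiffAt (modelCoT E) 𝓘(ℝ, ℝ) ∞ (φ μ) (legendre L v))
    (hlam : ∀ μ, ContMDiffAt (modelT E) 𝓘(ℝ, ℝ) ∞ (lam μ) v)
    (heq : ∀ᶠ w in 𝓝 v, w.2 = gam L H w + ∑ μ, lam μ w • gam L (φ μ) w) :
    ContinuousLinearMap.id ℝ (TangentSpace 𝓘(ℝ, E) v.1) =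
      opM L H φ lam v ∘L hessian L v + ∑ μ, (DT (lam μ) v).smulRight (gam L (φ μ) v) := by
  have hfibre := (hasMFDerivAt_mk_tangentSpace (E := E) v.1 v.2).continuousAt
  have hderiv := hasFDerivAt_comp_add_sum_smul_comp (X := E) (Y := E →L[ℝ] ℝ)
    (lam := fun μ (w : E) => lam μ ⟨v.1, w⟩) (hasFDerivAt_DT hL) (hasFDerivAt_DCoT hH)
    (fun μ => hasFDerivAt_DCoT (hφ μ))
    (fun μ => ((contDiffAt_tangentSpace (hlam μ)).differentiableAt (by simp)).hasFDerivAt)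
  have hid := (hasFDerivAt_id (𝕜 := ℝ) (E := E) v.2).unique
    (hderiv.congr_of_eventuallyEq (hfibre.eventually heq))
  exact hid

end Multipliers

end Tangent

end FibreDer

theorem proposition4_general
    {E : Type*} [NormedAddCommGroup E] [NormedSpace ℝ E] [FiniteDimensional ℝ E]
    {Q : Type*} [TopologicalSpace Q] [ChartedSpace E Q] [IsManifold 𝓘(ℝ, E) ∞ Q]
    (L : TangentBundle 𝓘(ℝ, E) Q → ℝ) (hL : ContMDiff (modelT E) 𝓘(ℝ, ℝ) ∞ L)
    (U : Set (CotangentBundle E Q)) (hU : IsOpen U)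
    (hsub : ∀ v ∈ legendre L ⁻¹' U,
      tangentTo (modelCoT E) (range (legendre L)) (legendre L v) ⊆
        range (mfderiv (modelT E) (modelCoT E) (legendre L) v))
    {ι : Type*} [Fintype ι] (φ : ι → CotangentBundle E Q → ℝ)
    (hφ : IsIndependentPrimaryConstraints L U φ)
    (H : CotangentBundle E Q → ℝ) (hH : IsHamiltonian L U H) :
    IsOpen (legendre L ⁻¹' U) ∧
    ∃ lam : ι → TangentBundle 𝓘(ℝ, E) Q → ℝ,
      (∀ μ, ContMDiffOn (modelT E) 𝓘(ℝ, ℝ) ∞ (lam μ) (legendre L ⁻¹' U)) ∧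
      (∀ v ∈ legendre L ⁻¹' U, v.2 = gam L H v + ∑ μ, lam μ v • gam L (φ μ) v) ∧
      (∀ v ∈ legendre L ⁻¹' U,
        ContinuousLinearMap.id ℝ (TangentSpace 𝓘(ℝ, E) v.1) =
          opM L H φ lam v ∘L hessian L v +
            ∑ μ, (DT (lam μ) v).smulRight (gam L (φ μ) v)) := by
  have hopen : IsOpen (legendre L ⁻¹' U) :=
    hU.preimage (ContMDiff.continuous fun v => contMDiffAt_legendre (hL v))
  have hφ_at : ∀ v ∈ legendre L ⁻¹' U, ∀ μ,
      ContMDiffAt (modelCoT E) 𝓘(ℝ, ℝ) ∞ (φ μ) (legendre L v) := fun v hv μ =>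
    (hφ.smooth μ).contMDiffAt (hU.mem_nhds hv)
  have hH_at : ∀ v ∈ legendre L ⁻¹' U, ContMDiffAt (modelCoT E) 𝓘(ℝ, ℝ) ∞ H (legendre L v) :=
    fun v hv => hH.smooth.contMDiffAt (hU.mem_nhds hv)
  have hdφ : ∀ v ∈ legendre L ⁻¹' U,
      LinearIndependent ℝ fun μ => mvfderiv (modelCoT E) (φ μ) (legendre L v) := fun v hv =>
    hφ.independent _ hv (mem_range_self v)
  have hzero : ∀ v ∈ legendre L ⁻¹' U, ∀ μ, φ μ (legendre L v) = 0 := fun v hv =>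
    (hφ.mem_range_iff _ hv).1 (mem_range_self v)
  have hnhds : ∀ v ∈ legendre L ⁻¹' U, ∀ᶠ w in 𝓝 v, w ∈ legendre L ⁻¹' U := fun v =>
    hopen.mem_nhds
  choose! c hc using fun v (hv : v ∈ legendre L ⁻¹' U) =>
    exists_eq_gam_add_sum_smul_gam (hL v) (hsub v hv) (hφ_at v hv) (hdφ v hv) (hzero v hv)
      ((hU.eventually_mem hv).mono fun p hp => (hφ.mem_range_iff p hp).2) (hH_at v hv)
      ((hnhds v hv).mono hH.energy_eq)
  have hc_at : ∀ v ∈ legendre L ⁻¹' U, ∀ μ, ContMDiffAt (modelT E) 𝓘(ℝ, ℝ) ∞ (c · μ) v :=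
    fun v hv => contMDiffAt_of_eq_gam_add_sum_smul_gam (hL v) (hH_at v hv) (hφ_at v hv)
      (linearIndependent_gam (hL v) (hφ_at v hv) (hdφ v hv) ((hnhds v hv).mono hzero))
      ((hnhds v hv).mono hc)
  exact ⟨hopen, fun μ v => c v μ, fun μ v hv => (hc_at v hv μ).contMDiffWithinAt, hc, fun v hv =>
    id_eq_opM_comp_hessian_add_sum (hL v) (hH_at v hv) (hφ_at v hv) (hc_at v hv)
      ((hnhds v hv).mono hc)⟩

theorem proposition4
    {E : Type*} [NormedAddCommGroup E] [NormedSpace ℝ E] [FiniteDimensional ℝ E]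
    {Q : Type*} [TopologicalSpace Q] [ChartedSpace E Q] [IsManifold 𝓘(ℝ, E) ∞ Q]
    (L : TangentBundle 𝓘(ℝ, E) Q → ℝ) (hL : AlmostRegular L)
    (U : Set (CotangentBundle E Q)) (hU : IsOpen U)
    {ι : Type*} [Fintype ι] (φ : ι → CotangentBundle E Q → ℝ)
    (hφ : IsIndependentPrimaryConstraints L U φ)
    (H : CotangentBundle E Q → ℝ) (hH : IsHamiltonian L U H) :
    IsOpen (legendre L ⁻¹' U) ∧
    ∃ lam : ι → TangentBundle 𝓘(ℝ, E) Q → ℝ,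
      (∀ μ, ContMDiffOn (modelT E) 𝓘(ℝ, ℝ) ∞ (lam μ) (legendre L ⁻¹' U)) ∧
      (∀ v ∈ legendre L ⁻¹' U, v.2 = gam L H v + ∑ μ, lam μ v • gam L (φ μ) v) ∧
      (∀ v ∈ legendre L ⁻¹' U,
        ContinuousLinearMap.id ℝ (TangentSpace 𝓘(ℝ, E) v.1) =
          opM L H φ lam v ∘L hessian L v +
            ∑ μ, (DT (lam μ) v).smulRight (gam L (φ μ) v)) :=
  proposition4_general L hL.smooth U hU (fun v _ => (hL.submersion v).ge) φ hφ H hH
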